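/- Let $M$ be an abelian group, $\Phi\subseteq M$, and $\alpha,\beta\in M$. For $q,p\in\mathbb Z_{\ge 0}$ the unbroken chain $\beta-q\alpha,\dots,\beta,\dots,\beta+p\alpha$ is a *root chain* of $\Phi$ through $\beta$ in the direction $\alpha$ if all its members lie in $\Phi\cup\{0\}$. It is *extremal*, with integer pair $(q,p)$, if $(q,p)$ is as large as possible, i.e. if it cannot be prolonged to a longer unbroken root chain through $\beta$ in the direction $\alpha$. The integer pair of an extremal root chain is determined by $\beta$ and $\alpha$, and $\langle\beta,\alpha\rangle=q-p$ is the *Killing integer*. A *sandwich algebra* is a complex Lie algebra $\widetilde{\mathfrak g}=\mathfrak g\oplus\widetilde{\mathfrak n}$ (direct sum of vector spaces), where $\mathfrak g$ is a simple subalgebra with a Cartan subalgebra $\mathfrak h$ and $\widetilde{\mathfrak n}$ is the nilradical of $\widetilde{\mathfrak g}$ (its largest nilpotent ideal), such that $[\widetilde{\mathfrak n},[\widetilde{\mathfrak n},\widetilde{\mathfrak n}]]=0$ and $\mathrm{ad}_{\mathfrak h}$ is toral on $\widetilde{\mathfrak n}$, i.e. $\widetilde{\mathfrak n}$ is the sum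 of its simultaneous $\mathrm{ad}_{\mathfrak h}$-eigenspaces. It is *very special* if it is a subalgebra of a finite-dimensional complex simple Lie algebra $\underline{\mathfrak g}$ of rank one greater than the rank of $\mathfrak g$, with a Cartan subalgebra $\underline{\mathfrak h}$ such that $\mathfrak h$ and $\underline{\mathfrak h}$ are aligned: $\mathfrak h\subseteq\underline{\mathfrak h}$, and there is $\underline H^*\in\underline{\mathfrak h}$ such that the roots of $(\mathfrak g,\mathfrak h)$ are the roots $\underline\alpha$ of $(\underline{\mathfrak g},\underline{\mathfrak h})$ with $\underline\alpha(\underline H^*)=0$, in the sense that the root spaces of $\mathfrak g$ are exactly the root spaces of $\underline{\mathfrak g}$ for these $\underline\alpha$. It is *of class $\mathcal C$* if the center of $\widetilde{\mathfrak n}$ has complex dimension $1$. **Lemma 2.4.1.** Let $\widetilde{\mathfrak g}=\mathfrak g\oplus\widetilde{\mathfrak n}$ be a very special sandwich algebra of class $\mathcal C$, and let $\Phi\subseteq\mathfrak h^*$ be the set of nonzero roots of $\widetilde{\mathfrak n}$, that is, of the nonzero linear functions $\widehat\alpha$ on $\mathfrak h$ for which $\{X\in\widetilde{\mathfrak n}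 : [H,X]=\widehat\alpha(H)X \text{ for all } H\in\mathfrak h\}$ is nonzero. Then for every $\widehat\alpha\in\Phi$ the extremal root chain of $\Phi$ through $\widehat\alpha$ in the direction $\widehat\alpha$ is $-\widehat\alpha,\,0,\,\widehat\alpha$, with integer pair $(2,0)$. Hence the Killing integer $\langle\widehat\alpha,\widehat\alpha\rangle$ is equal to $2$. -/

import Mathlib

/-! ### Root chains in a subset of an additive group -/

section RootChains

variable {M : Type*} [AddCommGroup M]

/-- The unbroken chain `β - q α, …, β, …, β + p α` through `β` in the direction `α` with integer
pair `(q, p)`, as a set. -/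
def unbrokenChain (β α : M) (q p : ℕ) : Set M :=
  {γ | ∃ j : ℤ, -(q : ℤ) ≤ j ∧ j ≤ (p : ℤ) ∧ γ = β + j • α}

/-- The unbroken chain with integer pair `(q, p)` is a root chain of `Φ`: all its members lie in
`Φ ∪ {0}`. -/
def IsUnbrokenRootChain (Φ : Set M) (β α : M) (q p : ℕ) : Prop :=
  unbrokenChain β α q p ⊆ Φ ∪ {0}

/-- The unbroken chain through `β` in the direction `α` with integer pair `(q, p)` is an extremal
root chain of `Φ`: it is a root chain and `q`, `p` are as large as possible, i.e. it cannot be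
prolonged to another unbroken root chain through `β` in the direction `α`. -/
def IsExtremalRootChain (Φ : Set M) (β α : M) (q p : ℕ) : Prop :=
  IsUnbrokenRootChain Φ β α q p ∧
    ∀ q' p' : ℕ, IsUnbrokenRootChain Φ β α q' p' → q ≤ q' → p ≤ p' → q' = q ∧ p' = p

/-- The integer pair of an extremal root chain is determined by `β` and `α`. -/
theorem IsExtremalRootChain.unique {Φ : Set M} {β α : M} {q p q' p' : ℕ}
    (h : IsExtremalRootChain Φ β α q p) (h' : IsExtremalRootChain Φ β α q' p') :
    q = q' ∧ p = p' := by
  have key : IsUnbrokenRootChain Φ β α (max q q') (max p p') := by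
    rintro γ ⟨j, hj, hj', rfl⟩
    rcases le_total 0 j with h0 | h0
    · rcases le_total p p' with hp | hp
      · exact h'.1 ⟨j, by omega, by omega, rfl⟩
      · exact h.1 ⟨j, by omega, by omega, rfl⟩
    · rcases le_total q q' with hq | hq
      · exact h'.1 ⟨j, by omega, by omega, rfl⟩
      · exact h.1 ⟨j, by omega, by omega, rfl⟩
  have h1 := h.2 _ _ key (le_max_left _ _) (le_max_left _ _)
  have h2 := h'.2 _ _ key (le_max_right _ _) (le_max_right _ _)
  omega

open Classical in
/-- The Killing integer `⟨β, α⟩ = q - p`, where `(q, p)` is the integer pair of the extremal root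
chain of `Φ` through `β` in the direction `α` (and `0` if there is no such chain). -/
noncomputable def killingInteger (Φ : Set M) (β α : M) : ℤ :=
  if h : ∃ qp : ℕ × ℕ, IsExtremalRootChain Φ β α qp.1 qp.2 then
    (h.choose.1 : ℤ) - (h.choose.2 : ℤ)
  else 0

end RootChains

/-! ### Sandwich algebras -/

/-- The nilradical of a complex Lie algebra: the largest ideal that is nilpotent as a Lie algebra.
(Mathlib's `LieAlgebra.maxNilpotentIdeal` is a different ideal: it asks for nilpotency as a module
over the whole Lie algebra.) -/
def nilpotentRadical (L : Type*) [LieRing L] [LieAlgebra ℂ L] : LieIdeal ℂ L :=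
  sSup {I : LieIdeal ℂ L | LieRing.IsNilpotent I}

/-- The linear functionals `α` on `t` whose simultaneous eigenspace
`{m ∈ M | ⁅H, m⁆ = α(H) m for all H ∈ t}` is nonzero. -/
def weightSet (t M : Type*) [LieRing t] [LieAlgebra ℂ t] [LieRing.IsNilpotent t]
    [AddCommGroup M] [Module ℂ M] [LieRingModule t M] [LieModule ℂ t M] :
    Set (Module.Dual ℂ t) :=
  {α | LieModule.weightSpace M (α : t → ℂ) ≠ ⊥}

/-- The nonzero weights, that is, the roots when `t` is a Cartan subalgebra of a semisimple Lie
algebra `M`. -/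
def rootSet (t M : Type*) [LieRing t] [LieAlgebra ℂ t] [LieRing.IsNilpotent t]
    [AddCommGroup M] [Module ℂ M] [LieRingModule t M] [LieModule ℂ t M] :
    Set (Module.Dual ℂ t) :=
  {α | α ∈ weightSet t M ∧ α ≠ 0}

section Sandwich

variable {L : Type*} [LieRing L] [LieAlgebra ℂ L]

/-- `L = g ⊕ n` is a sandwich algebra with simple part `g`, Cartan subalgebra `h` of `g`, and
nilradical `n`. -/
structure IsSandwichAlgebra (g : LieSubalgebra ℂ L) (h : LieSubalgebra ℂ g)
    [h.IsCartanSubalgebra] : Prop where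
  simple : LieAlgebra.IsSimple ℂ g
  isCompl : IsCompl g.toSubmodule (nilpotentRadical L).toSubmodule
  sandwich : ∀ x ∈ nilpotentRadical L, ∀ y ∈ nilpotentRadical L, ∀ z ∈ nilpotentRadical L, ⁅x, ⁅y, z⁆⁆ = 0
  /-- `ad_h` acts on the nilradical as a toral algebra. -/
  toral : ⨆ α : Module.Dual ℂ h, LieModule.weightSpace (nilpotentRadical L) (α : h → ℂ) = ⊤

/-- Let `φ` embed `g`, with Cartan subalgebra `h`, in `G`, with Cartan subalgebra `H`. The Cartan
subalgebras are aligned if `h` lies in `H` and there is a vector `Hs ∈ H` such that the roots of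
`(g, h)` are the roots of `(G, H)` that vanish at `Hs`: the root spaces of `g` are the root spaces
of `G` for these roots (so that each root of `g` is the restriction to `h` of such a root). -/
def IsAligned {g G : Type*} [LieRing g] [LieAlgebra ℂ g] [LieRing G] [LieAlgebra ℂ G]
    (φ : g →ₗ⁅ℂ⁆ G) (h : LieSubalgebra ℂ g) (H : LieSubalgebra ℂ G)
    [h.IsCartanSubalgebra] [H.IsCartanSubalgebra] : Prop :=
  h.map φ ≤ H ∧ ∃ Hs : H,
    {W : Submodule ℂ G | ∃ α ∈ rootSet h g,
        W = (LieModule.weightSpace g (α : h → ℂ)).toSubmodule.map (φ : g →ₗ[ℂ] G)} =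
      {W : Submodule ℂ G | ∃ γ ∈ rootSet H G, γ Hs = 0 ∧
        W = (LieModule.weightSpace G (γ : H → ℂ)).toSubmodule}

/-- The sandwich algebra `L = g ⊕ n` is very special: it is embedded by `ι` in the simple Lie
algebra `G` of rank one greater than the rank of `g`, with aligned Cartan subalgebras. -/
structure IsVerySpecial (g : LieSubalgebra ℂ L) (h : LieSubalgebra ℂ g) [h.IsCartanSubalgebra]
    {G : Type*} [LieRing G] [LieAlgebra ℂ G] (ι : L →ₗ⁅ℂ⁆ G)
    (H : LieSubalgebra ℂ G) [H.IsCartanSubalgebra] : Prop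
    extends IsSandwichAlgebra g h where
  simple_ambient : LieAlgebra.IsSimple ℂ G
  injective : Function.Injective ι
  rank_eq : Module.finrank ℂ H = Module.finrank ℂ h + 1
  aligned : IsAligned (ι.comp g.incl) h H

/-- Class `C`: the center of the nilradical has complex dimension `1`. -/
def IsClassC (L : Type*) [LieRing L] [LieAlgebra ℂ L] : Prop :=
  Module.finrank ℂ (LieAlgebra.center ℂ (nilpotentRadical L)) = 1

end Sandwich

/-! It must be shown that `-α` is a root of the nilradical `n` and that `2α`, `-2α` are not. The
line that is the center of `n` is preserved, hence annihilated, by the simple algebra `g`. It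
contains `[n, n]`. So a vector `x` of weight `α ≠ 0` is not central, and it can only fail to commute
with vectors of weight `-α` (`IsSandwichAlgebra.exists_lie_ne_zero`). Let `z = [x, x'] ≠ 0` be such
a bracket, seen in the ambient algebra `G`. It commutes with `h`, `x` and `x'`, and a trace argument
shows that it cannot lie in `H`. Hence some root `δ` of `G` vanishes on `h`, and by the rank
condition `h = ker δ`. Alignment then makes `Hs` a multiple of the coroot of `δ`, so that every root
orthogonal to `δ` has its root space in `g`. A root of `G` restricting to `2α` has the form `2γ₁ +
tδ`, where `γ₁` is a root restricting to `α`. By a property of root systems it is orthogonal to `δ`.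
So vectors of weight `2α` lie in `g`, which meets `n` in zero. -/

/-- In a reduced crystallographic root pairing, let `β` be a root other than `± δ`. A root that
differs from `2 β` by a multiple of `δ` is orthogonal to `δ`. -/
theorem RootPairing.pairingIn_eq_zero_of_root_eq_two_smul_add_smul
    {ι R M N : Type*} [Finite ι] [Field R] [CharZero R] [AddCommGroup M] [Module R M]
    [AddCommGroup N] [Module R N] (P : RootPairing ι R M N) [P.IsCrystallographic] [P.IsReduced]
    {i j k : ι} {t : R} (hk : P.root k = (2 : R) • P.root j + t • P.root i)
    (hne : P.root j ≠ P.root i) (hne' : P.root j ≠ -P.root i) :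
    P.pairingIn ℤ k i = 0 := by
  have cast (a b : ι) : P.pairing a b = (P.pairingIn ℤ a b : R) := by
    simpa using (P.algebraMap_pairingIn ℤ a b).symm
  have main (k : ι) (t : R) (hk : P.root k = (2 : R) • P.root j + t • P.root i)
      (h0 : P.pairingIn ℤ k i ≠ 0) (hsign : 0 ≤ P.pairingIn ℤ j i * P.pairingIn ℤ k i) :
      False := by
    have e1 : P.pairing k i = 2 * P.pairing j i + t * 2 := by
      have := congrArg (fun v => P.toLinearMap v (P.coroot i)) hk
      simpa using this
    have e2 : P.pairing k j = 2 * 2 + t * P.pairing i j := by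
      have := congrArg (fun v => P.toLinearMap v (P.coroot j)) hk
      simpa using this
    have e3 : 2 = 2 * P.pairing j k + t * P.pairing i k := by
      have := congrArg (fun v => P.toLinearMap v (P.coroot k)) hk
      simpa using this
    -- Eliminating `t` by `e1` and clearing the denominator leaves relations between integers, which
    -- the bounds on pairings reduce to finitely many cases.
    have f2 : 2 * P.pairingIn ℤ k j =
        8 + (P.pairingIn ℤ k i - 2 * P.pairingIn ℤ j i) * P.pairingIn ℤ i j := by
      have : (2 : R) * P.pairing k j =
          8 + (P.pairing k i - 2 * P.pairing j i) * P.pairing i j := by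
        rw [e1, e2]; ring
      simp only [cast] at this
      exact_mod_cast this
    have f3 : 4 = 4 * P.pairingIn ℤ j k +
        (P.pairingIn ℤ k i - 2 * P.pairingIn ℤ j i) * P.pairingIn ℤ i k := by
      have : (4 : R) = 4 * P.pairing j k +
          (P.pairing k i - 2 * P.pairing j i) * P.pairing i k := by
        rw [e1]; linear_combination 2 * e3
      simp only [cast] at this
      exact_mod_cast this
    have A := P.pairingIn_pairingIn_mem_set_of_isCrystal_of_isRed' j i hne hne'
    have B := P.pairingIn_pairingIn_mem_set_of_isCrystal_of_isRed k i
    have C : (P.pairingIn ℤ k j, P.pairingIn ℤ j k) ∈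
        ({(0, 0), (1, 1), (-1, -1), (1, 2), (2, 1), (-1, -2), (-2, -1), (1, 3), (3, 1), (-1, -3),
          (-3, -1)} : Set (ℤ × ℤ)) ∨ k = j ∨ P.root k = - P.root j := by
      by_cases h : P.root k = P.root j
      · exact Or.inr (Or.inl (P.root.injective h))
      by_cases h' : P.root k = -P.root j
      · exact Or.inr (Or.inr h')
      · exact Or.inl (P.pairingIn_pairingIn_mem_set_of_isCrystal_of_isRed' k j h h')
    have hkj : k = j → P.pairingIn ℤ k i = P.pairingIn ℤ j i ∧ P.pairingIn ℤ k j = 2 ∧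
        P.pairingIn ℤ i k = P.pairingIn ℤ i j := by
      rintro rfl
      exact ⟨rfl, by simp, rfl⟩
    have hkj' : P.root k = -P.root j → P.pairingIn ℤ k i = -P.pairingIn ℤ j i := by
      intro h
      have : P.pairing k i = -P.pairing j i := by
        have := congrArg (fun v => P.toLinearMap v (P.coroot i)) h
        simpa using this
      simp only [cast] at this
      exact_mod_cast this
    generalize P.pairingIn ℤ k i = c at *
    generalize P.pairingIn ℤ j i = b at *
    generalize P.pairingIn ℤ i j = p at *
    generalize P.pairingIn ℤ i k = q at *
    generalize P.pairingIn ℤ k j = m at *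
    generalize P.pairingIn ℤ j k = m' at *
    -- The last two alternatives are `k = j` and root `k` = −root `j`; in the latter, `hsign` forces
    -- `c = 0`.
    have C' : (-3 ≤ m ∧ m ≤ 3) ∧ (m = 3 → m' = 1) ∧ (m = 2 → m' = 1 ∨ c = b) ∨
        (c = b ∧ m = 2 ∧ q = p) ∨ c = -b := by
      rcases C with C | C | C
      · left
        simp only [Set.mem_insert_iff, Set.mem_singleton_iff, Prod.mk.injEq] at C
        omega
      · exact Or.inr (Or.inl (hkj C))
      · exact Or.inr (Or.inr (hkj' C))
    clear hkj hkj' C e1 e2 e3 hk cast hne hne'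
    have B' : (-3 ≤ c ∧ c ≤ 3) ∧ q ≠ 0 := by
      simp only [Set.mem_insert_iff, Set.mem_singleton_iff, Prod.mk.injEq] at B
      omega
    obtain ⟨⟨hc, hc'⟩, hq⟩ := B'
    simp only [Set.mem_insert_iff, Set.mem_singleton_iff, Prod.mk.injEq] at A
    clear B
    rcases A with A | A | A | A | A | A | A | A | A | A | A <;> obtain ⟨rfl, rfl⟩ := A <;>
      interval_cases c <;> omega
  by_contra h0
  by_cases hsign : 0 ≤ P.pairingIn ℤ j i * P.pairingIn ℤ k i
  · exact main k t hk h0 hsign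
  -- The reflection in `δ` keeps the form `2β + tδ` and reverses the sign of the pairing with `δ`.
  · have hr : P.pairingIn ℤ (P.reflectionPerm i k) i = -P.pairingIn ℤ k i := by
      have : P.pairing (P.reflectionPerm i k) i = -P.pairing k i := by
        rw [← P.pairing_reflectionPerm, P.pairing_reflectionPerm_self_right]
      simp only [cast] at this
      exact_mod_cast this
    refine main (P.reflectionPerm i k) (t - P.pairing k i) ?_ (by simpa [hr] using h0) ?_
    · rw [P.root_reflectionPerm, P.reflection_apply_root, hk]
      module
    · rw [hr]; nlinarith

/-- `A` and `B` preserve the `c`-eigenspace of their commutator. There the commutator is the scalar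
`c` and has trace zero, so `c` times the dimension vanishes. -/
theorem Module.End.eigenvalue_eq_zero_of_commute_lie {K V : Type*} [Field K] [CharZero K]
    [AddCommGroup V] [Module K V] [FiniteDimensional K V] {A B : Module.End K V}
    (hA : Commute A (A * B - B * A)) (hB : Commute B (A * B - B * A))
    {c : K} {v : V} (hv : v ≠ 0) (hc : (A * B - B * A) v = c • v) : c = 0 := by
  set C := A * B - B * A with hC
  let E := C.eigenspace c
  have hAE : ∀ w ∈ E, A w ∈ E := fun w hw => by
    rw [Module.End.mem_eigenspace_iff] at hw ⊢
    rw [← Module.End.mul_apply, ← hA.eq, Module.End.mul_apply, hw, map_smul]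
  have hBE : ∀ w ∈ E, B w ∈ E := fun w hw => by
    rw [Module.End.mem_eigenspace_iff] at hw ⊢
    rw [← Module.End.mul_apply, ← hB.eq, Module.End.mul_apply, hw, map_smul]
  have key : A.restrict hAE * B.restrict hBE - B.restrict hBE * A.restrict hAE =
      c • (1 : Module.End K E) := by
    ext w
    have := Module.End.mem_eigenspace_iff.mp w.2
    simpa [hC] using this
  have htr := congrArg (LinearMap.trace K E) key
  rw [map_sub, LinearMap.trace_mul_comm, sub_self, map_smul, LinearMap.trace_one,
    smul_eq_mul, eq_comm, mul_eq_zero] at htr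
  refine htr.resolve_right ?_
  have : Nontrivial E :=
    ⟨⟨⟨v, Module.End.mem_eigenspace_iff.mpr hc⟩, 0, fun h => hv (congrArg Subtype.val h)⟩⟩
  exact_mod_cast (Module.finrank_pos (R := K) (M := E)).ne'

open LieAlgebra LieAlgebra.IsKilling LieModule

/-! ### Roots restricted to a hyperplane of the Cartan subalgebra -/

section Killing

variable {K G : Type*} [Field K] [CharZero K] [LieRing G] [LieAlgebra K G]
  [FiniteDimensional K G] [IsKilling K G] {H : LieSubalgebra K G} [H.IsCartanSubalgebra]
  [IsTriangularizable K H G]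
  {V : Type*} [AddCommGroup V] [Module K V]

/-- A simultaneous eigenvector of a subspace of a Cartan subalgebra is a sum of elements of root
spaces whose weights restrict to the given functional. -/
theorem LieAlgebra.IsKilling.mem_iSup_rootSpace_of_restrict_eq (f : V →ₗ[K] H) {α : V → K} {x : G}
    (hx : ∀ v, ⁅(f v : G), x⁆ = α v • x) :
    x ∈ ⨆ γ : {γ : Weight K H G // ∀ v, γ (f v) = α v},
      (rootSpace H (γ : Weight K H G)).toSubmodule := by
  have htop : x ∈ ⨆ γ : Weight K H G, (rootSpace H γ).toSubmodule := by
    rw [← LieSubmodule.iSup_toSubmodule, iSup_genWeightSpace_eq_top' K H G]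
    trivial
  obtain ⟨s, hs, rfl⟩ := (Submodule.mem_iSup_iff_exists_finsupp _ _).mp htop
  have hind : iSupIndep fun γ : Weight K H G => (rootSpace H γ).toSubmodule :=
    LieSubmodule.iSupIndep_toSubmodule.mpr (iSupIndep_genWeightSpace' K H G)
  -- Root spaces are independent, so the eigenvector equation holds in each component.
  have hz : ∀ v, ∀ γ ∈ s.support, (γ (f v) - α v) • s γ = 0 := by
    intro v
    refine iSupIndep_iff_finsetSum_eq_zero_imp_eq_zero _ |>.mp hind s.support _
      (fun γ _ => Submodule.smul_mem _ _ (hs γ)) ?_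
    have h1 := hx v
    rw [Finsupp.sum, Finset.smul_sum, lie_sum, ← sub_eq_zero, ← Finset.sum_sub_distrib] at h1
    rw [← h1]
    refine Finset.sum_congr rfl fun γ _ => ?_
    have h2 : ⁅(f v : G), s γ⁆ = γ (f v) • s γ := lie_eq_smul_of_mem_rootSpace (hs γ) (f v)
    rw [h2, sub_smul]
  refine Submodule.sum_mem _ fun γ hγ => ?_
  have hr : ∀ v, γ (f v) = α v := fun v =>
    sub_eq_zero.mp ((smul_eq_zero.mp (hz v γ hγ)).resolve_right (Finsupp.mem_support_iff.mp hγ))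
  exact Submodule.mem_iSup_of_mem (⟨γ, hr⟩ : {γ : Weight K H G // ∀ v, γ (f v) = α v}) (hs γ)

theorem LieAlgebra.IsKilling.exists_weight_restrict_eq (f : V →ₗ[K] H) {α : V → K} {x : G}
    (hx0 : x ≠ 0) (hx : ∀ v, ⁅(f v : G), x⁆ = α v • x) :
    ∃ γ : Weight K H G, ∀ v, γ (f v) = α v := by
  by_contra! hne
  have : IsEmpty {γ : Weight K H G // ∀ v, γ (f v) = α v} :=
    ⟨fun γ => (hne γ).elim fun v hv => hv (γ.2 v)⟩
  have h := mem_iSup_rootSpace_of_restrict_eq f hx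
  rw [iSup_of_empty, Submodule.mem_bot] at h
  exact hx0 h

/-- An element of a Cartan subalgebra that is the bracket of two elements commuting with it is
zero. -/
theorem LieAlgebra.IsKilling.lie_eq_zero_of_mem_cartan {x y : G} (hz : ⁅x, y⁆ ∈ H)
    (hx : ⁅x, ⁅x, y⁆⁆ = 0) (hy : ⁅y, ⁅x, y⁆⁆ = 0) : ⁅x, y⁆ = 0 := by
  have hC : ad K G x * ad K G y - ad K G y * ad K G x = ad K G ⁅x, y⁆ := by
    ext v
    simp
  have hcomm (w : G) (hw : ⁅w, ⁅x, y⁆⁆ = 0) :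
      Commute (ad K G w) (ad K G x * ad K G y - ad K G y * ad K G x) := by
    rw [hC]
    ext v
    change ⁅w, ⁅⁅x, y⁆, v⁆⁆ = ⁅⁅x, y⁆, ⁅w, v⁆⁆
    rw [leibniz_lie w ⁅x, y⁆ v, hw, zero_lie, zero_add]
  -- Each `γ ⁅x, y⁆` is an eigenvalue of the commutator of `ad x` and `ad y`, hence zero; the
  -- weights have no common zero other than `0`.
  have hmem : (⟨⁅x, y⁆, hz⟩ : H) ∈ ⨅ γ : Weight K H G, γ.ker := by
    rw [Submodule.mem_iInf]
    intro γ
    obtain ⟨v, hv, hv0⟩ := γ.exists_ne_zero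
    refine Module.End.eigenvalue_eq_zero_of_commute_lie (hcomm x hx) (hcomm y hy) hv0 ?_
    rw [hC]
    exact lie_eq_smul_of_mem_rootSpace hv ⟨_, hz⟩
  rw [iInf_ker_weight_eq_bot, Submodule.mem_bot] at hmem
  exact congrArg Subtype.val hmem

/-- Otherwise the centralizer of the image of `f` would be `H` itself, and `⁅x, y⁆` would be an
element of `H` to which `lie_eq_zero_of_mem_cartan` applies. -/
theorem LieAlgebra.IsKilling.exists_isNonZero_restrict_eq_zero (f : V →ₗ[K] H) {x y : G}
    (hz0 : ⁅x, y⁆ ≠ 0) (hx : ⁅x, ⁅x, y⁆⁆ = 0) (hy : ⁅y, ⁅x, y⁆⁆ = 0)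
    (hz : ∀ v, ⁅(f v : G), ⁅x, y⁆⁆ = 0) :
    ∃ δ : Weight K H G, δ.IsNonZero ∧ ∀ v, δ (f v) = 0 := by
  by_contra! hne
  refine hz0 (lie_eq_zero_of_mem_cartan (H := H) ?_ hx hy)
  have h1 := mem_iSup_rootSpace_of_restrict_eq f (α := 0) (x := ⁅x, y⁆) (by simpa using hz)
  refine (iSup_le fun γ => ?_ : _ ≤ H.toSubmodule) h1
  have hγ : (γ : Weight K H G).IsZero := by
    by_contra h
    obtain ⟨v, hv⟩ := hne γ h
    exact hv (γ.2 v)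
  have h0 : rootSpace H (γ : Weight K H G) = H.toLieSubmodule := by
    have : ((γ : Weight K H G) : H → K) = 0 := hγ
    rw [this]
    simp
  rw [h0]
  simp

/-- A root vanishing on a hyperplane of the Cartan subalgebra has this hyperplane as its kernel,
and its coroot spans a complement. -/
theorem LieAlgebra.IsKilling.exists_eq_add_smul_coroot (f : V →ₗ[K] H)
    (hf : Function.Injective f) (hdim : Module.finrank K H = Module.finrank K V + 1)
    {δ : Weight K H G} (hδ : δ.IsNonZero) (hδf : ∀ v, δ (f v) = 0) (w : H) :
    ∃ v, w = f v + (δ w / 2) • coroot δ := by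
  have hrange : LinearMap.range f = LinearMap.ker δ.toLinear := by
    have : FiniteDimensional K V := Module.Finite.of_injective f hf
    refine Submodule.eq_of_le_of_finrank_eq ?_ ?_
    · rintro _ ⟨v, rfl⟩
      exact hδf v
    · have h1 := LinearMap.finrank_range_of_inj hf
      have h2 := Module.Dual.finrank_ker_add_one_of_ne_zero (f := δ.toLinear)
        (by simpa using hδ)
      omega
  have h2 : δ (coroot δ) = 2 := root_apply_coroot hδ
  obtain ⟨v, hv⟩ : w - (δ w / 2) • coroot δ ∈ LinearMap.range f := by
    rw [hrange, LinearMap.mem_ker, map_sub, map_smul, Weight.toLinear_apply,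
      Weight.toLinear_apply, h2, smul_eq_mul]
    field_simp
    ring
  exact ⟨v, by rw [hv]; abel⟩

/-- Let `δ` be a root vanishing on a hyperplane `f V` of the Cartan subalgebra, and let `Hs` be a
vector such that the coroots of the roots vanishing at `Hs` lie in `f V` and the roots vanishing at
`Hs` separate the points of `V`. Then the roots orthogonal to `δ` vanish at `Hs`. -/
theorem LieAlgebra.IsKilling.apply_eq_zero_of_apply_coroot_eq_zero (f : V →ₗ[K] H)
    (hf : Function.Injective f) (hdim : Module.finrank K H = Module.finrank K V + 1)
    {δ : Weight K H G} (hδ : δ.IsNonZero) (hδf : ∀ v, δ (f v) = 0) (Hs : H)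
    (hcor : ∀ γ : Weight K H G, γ.IsNonZero → γ Hs = 0 → coroot γ ∈ LinearMap.range f)
    (hsep : ∀ v, (∀ γ : Weight K H G, γ.IsNonZero → γ Hs = 0 → γ (f v) = 0) → v = 0)
    {γ : Weight K H G} (hγ : γ (coroot δ) = 0) : γ Hs = 0 := by
  obtain ⟨v, hHs⟩ := exists_eq_add_smul_coroot f hf hdim hδ hδf Hs
  -- A root vanishing at `Hs` has its coroot in `f V`, where `δ` is zero. So it is orthogonal to `δ`
  -- and vanishes at `f v` too. Thus `Hs` is a multiple of the coroot of `δ`.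
  have hv0 : v = 0 := by
    refine hsep v fun γ h0 hγs => ?_
    obtain ⟨w, hw⟩ := hcor γ h0 hγs
    have hδγ : δ (coroot γ) = 0 := by rw [← hw]; exact hδf w
    have hγδ : γ (coroot δ) = 0 := by
      have := (rootSystem H).pairing_eq_zero_iff' (i := ⟨δ, by simpa using hδ⟩)
        (j := ⟨γ, by simpa using h0⟩)
      exact this.mp hδγ
    have := congrArg γ.toLinear hHs
    rw [map_add, map_smul] at this
    simp only [Weight.toLinear_apply, hγs, hγδ, smul_zero, add_zero] at this
    exact this.symm
  have := congrArg γ.toLinear hHs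
  rw [map_add, map_smul, hv0, map_zero, map_zero] at this
  simpa [hγ] using this

/-- Under the hypotheses of `apply_eq_zero_of_apply_coroot_eq_zero`, if `α` is a nonzero
weight of `V`, then the `2 α`-eigenvectors lie in root spaces of roots that vanish at `Hs`. -/
theorem LieAlgebra.IsKilling.mem_of_restrict_eq_two_smul (f : V →ₗ[K] H)
    (hf : Function.Injective f) (hdim : Module.finrank K H = Module.finrank K V + 1)
    {δ : Weight K H G} (hδ : δ.IsNonZero) (hδf : ∀ v, δ (f v) = 0) (Hs : H)
    (hcor : ∀ γ : Weight K H G, γ.IsNonZero → γ Hs = 0 → coroot γ ∈ LinearMap.range f)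
    (hsep : ∀ v, (∀ γ : Weight K H G, γ.IsNonZero → γ Hs = 0 → γ (f v) = 0) → v = 0)
    (S : Submodule K G)
    (hS : ∀ γ : Weight K H G, γ.IsNonZero → γ Hs = 0 → (rootSpace H γ).toSubmodule ≤ S)
    {α : Module.Dual K V} (hα : α ≠ 0) {x y : G} (hx0 : x ≠ 0)
    (hx : ∀ v, ⁅(f v : G), x⁆ = α v • x) (hy : ∀ v, ⁅(f v : G), y⁆ = (2 * α v) • y) : y ∈ S := by
  obtain ⟨v₀, hv₀⟩ : ∃ v, α v ≠ 0 := by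
    by_contra! h
    exact hα (LinearMap.ext h)
  obtain ⟨γ₁, hγ₁⟩ := exists_weight_restrict_eq f hx0 hx
  refine (iSup_le fun γ => ?_ : _ ≤ S) (mem_iSup_rootSpace_of_restrict_eq f hy)
  obtain ⟨γ, hγ⟩ := γ
  have n₁ : γ₁.IsNonZero := fun h => hv₀ (by rw [← hγ₁]; exact congrFun h _)
  have n₂ : γ.IsNonZero := fun h => hv₀ (by
    have := hγ v₀
    rw [show γ (f v₀) = 0 from congrFun h _, eq_comm, mul_eq_zero] at this
    exact this.resolve_left two_ne_zero)
  refine hS γ n₂ (apply_eq_zero_of_apply_coroot_eq_zero f hf hdim hδ hδf Hs hcor hsep ?_)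
  -- `γ - 2γ₁` vanishes on `f V`, the kernel of `δ`. The factor `t` is read off at the coroot of
  -- `δ`, where `δ` takes the value `2`.
  have hspan : ∃ t : K, γ.toLinear = (2 : K) • γ₁.toLinear + t • δ.toLinear := by
    refine ⟨(γ (coroot δ) - 2 * γ₁ (coroot δ)) / 2, LinearMap.ext fun w => ?_⟩
    obtain ⟨v, hv⟩ := exists_eq_add_smul_coroot f hf hdim hδ hδf w
    have e₁ := congrArg γ.toLinear hv
    have e₂ := congrArg γ₁.toLinear hv
    simp only [map_add, map_smul, Weight.toLinear_apply, hγ, hγ₁, smul_eq_mul] at e₁ e₂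
    simp only [LinearMap.add_apply, LinearMap.smul_apply, Weight.toLinear_apply, smul_eq_mul]
    rw [e₁, e₂]
    ring
  obtain ⟨t, ht⟩ := hspan
  have key := (rootSystem H).pairingIn_eq_zero_of_root_eq_two_smul_add_smul
    (i := ⟨δ, by simpa using hδ⟩) (j := ⟨γ₁, by simpa using n₁⟩) (k := ⟨γ, by simpa using n₂⟩)
    (t := t) ht
    (fun h => hv₀ (by
      have : γ₁ (f v₀) = δ (f v₀) := LinearMap.congr_fun h (f v₀)
      rw [← hγ₁, this, hδf]))
    (fun h => hv₀ (by
      have : γ₁ (f v₀) = -δ (f v₀) := LinearMap.congr_fun h (f v₀)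
      rw [← hγ₁, this, hδf, neg_zero]))
  have := (rootSystem H).algebraMap_pairingIn ℤ ⟨γ, by simpa using n₂⟩ ⟨δ, by simpa using hδ⟩
  rw [key, map_zero] at this
  exact this.symm

end Killing

theorem mem_weightSet_iff {t M : Type*} [LieRing t] [LieAlgebra ℂ t] [LieRing.IsNilpotent t]
    [AddCommGroup M] [Module ℂ M] [LieRingModule t M] [LieModule ℂ t M] {α : Module.Dual ℂ t} :
    α ∈ weightSet t M ↔ ∃ m : M, m ≠ 0 ∧ ∀ v : t, ⁅v, m⁆ = α v • m := by
  simp only [weightSet, Set.mem_ofPred_eq, Ne, LieSubmodule.eq_bot_iff, not_forall, mem_weightSpace]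
  exact ⟨fun ⟨m, h, h0⟩ => ⟨m, h0, h⟩, fun ⟨m, h0, h⟩ => ⟨m, h, h0⟩⟩

/-- The nonzero weights of a Cartan subalgebra of a Lie algebra with nondegenerate Killing form are
its roots. -/
theorem LieModule.Weight.toLinear_mem_rootSet {G : Type*} [LieRing G] [LieAlgebra ℂ G]
    [FiniteDimensional ℂ G] [IsKilling ℂ G] {H : LieSubalgebra ℂ G} [H.IsCartanSubalgebra]
    {γ : Weight ℂ H G} (hγ : γ.IsNonZero) : γ.toLinear ∈ rootSet H G := by
  refine ⟨mem_weightSet_iff.mpr ?_, by simpa using hγ⟩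
  obtain ⟨x, hx, hx0⟩ := γ.exists_ne_zero
  exact ⟨x, hx0, fun v => lie_eq_smul_of_mem_rootSpace hx v⟩

theorem exists_weight_of_mem_rootSet {G : Type*} [LieRing G] [LieAlgebra ℂ G]
    {H : LieSubalgebra ℂ G} [LieRing.IsNilpotent H] {α : Module.Dual ℂ H} (hα : α ∈ rootSet H G) :
    ∃ γ : Weight ℂ H G, γ.IsNonZero ∧ (γ : H → ℂ) = α := by
  refine ⟨⟨α, fun h => hα.1 (eq_bot_iff.mpr (h ▸ weightSpace_le_genWeightSpace G (α : H → ℂ)))⟩,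
    fun h => hα.2 (LinearMap.ext fun v => congrFun h v), rfl⟩

theorem weightSpace_eq_rootSpace {G : Type*} [LieRing G] [LieAlgebra ℂ G]
    [FiniteDimensional ℂ G] [IsKilling ℂ G] {H : LieSubalgebra ℂ G} [H.IsCartanSubalgebra]
    (α : H → ℂ) : weightSpace G α = rootSpace H α :=
  le_antisymm (weightSpace_le_genWeightSpace G α) fun _ hx =>
    (mem_weightSpace _ _).mpr fun v => lie_eq_smul_of_mem_rootSpace hx v

/-! ### The center of the nilradical and the symmetry of its roots -/

section Nilradical

variable {L : Type*} [LieRing L] [LieAlgebra ℂ L] {g : LieSubalgebra ℂ L}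

/-- A simple Lie algebra annihilates a line that it preserves. -/
theorem LieAlgebra.IsSimple.lie_eq_zero_of_forall_exists_smul {g M : Type*} [LieRing g]
    [LieAlgebra ℂ g] [AddCommGroup M] [Module ℂ M] [LieRingModule g M] [LieModule ℂ g M]
    (hg : IsSimple ℂ g) {z : M} (hz : ∀ w : g, ∃ c : ℂ, ⁅w, z⁆ = c • z) (w : g) : ⁅w, z⁆ = 0 := by
  have hbr (u w : g) : ⁅⁅u, w⁆, z⁆ = 0 := by
    obtain ⟨a, ha⟩ := hz u
    obtain ⟨b, hb⟩ := hz w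
    rw [lie_lie, hb, lie_smul, ha, lie_smul, hb, smul_smul, smul_smul, mul_comm, sub_self]
  -- Scalars commute, so brackets annihilate `z`. The annihilator of `z` is therefore an ideal, and
  -- it is nonzero because `g` is not abelian.
  let I : LieIdeal ℂ g :=
    { carrier := {w | ⁅w, z⁆ = 0}
      add_mem' := fun {a b} ha hb => by
        simp only [Set.mem_ofPred_eq] at ha hb ⊢
        rw [add_lie, ha, hb, add_zero]
      zero_mem' := zero_lie z
      smul_mem' := fun c a ha => by
        simp only [Set.mem_ofPred_eq] at ha ⊢
        rw [smul_lie, ha, smul_zero]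
      lie_mem := fun {u w} _ => hbr u w }
  rcases hg.eq_bot_or_eq_top I with h | h
  · refine absurd ⟨fun u w => ?_⟩ hg.non_abelian
    have : ⁅u, w⁆ ∈ I := hbr u w
    rwa [h, LieSubmodule.mem_bot] at this
  · have : w ∈ I := h ▸ LieSubmodule.mem_top w
    exact this

/-- Elements of `g` act on the nilradical by derivations, which preserve its center; the center is a
line. -/
theorem lie_eq_zero_of_mem_center_nilpotentRadical (hg : IsSimple ℂ g) (hC : IsClassC L)
    {z : nilpotentRadical L} (hz : z ∈ center ℂ (nilpotentRadical L)) (w : g) :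
    ⁅w, z⁆ = 0 := by
  by_cases h0 : z = 0
  · rw [h0, lie_zero]
  refine IsSimple.lie_eq_zero_of_forall_exists_smul hg (fun w => ?_) w
  have hwz : ⁅w, z⁆ ∈ center ℂ (nilpotentRadical L) := by
    rw [mem_maxTrivSubmodule] at hz ⊢
    intro m
    have h1 : ⁅m, z⁆ = 0 := hz m
    have h2 : ⁅⁅w, m⁆, z⁆ = 0 := hz _
    apply Subtype.ext
    have h1' : ⁅(m : L), (z : L)⁆ = 0 := congrArg Subtype.val h1
    have h2' : ⁅⁅(w : L), (m : L)⁆, (z : L)⁆ = 0 := congrArg Subtype.val h2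
    change ⁅(m : L), ⁅(w : L), (z : L)⁆⁆ = 0
    rw [lie_lie, h1', lie_zero, zero_sub, neg_eq_zero] at h2'
    exact h2'
  obtain ⟨c, hc⟩ := (finrank_eq_one_iff_of_nonzero' (⟨z, hz⟩ : center ℂ (nilpotentRadical L))
    (fun h => h0 (congrArg Subtype.val h))).mp hC ⟨_, hwz⟩
  exact ⟨c, (congrArg Subtype.val hc).symm⟩

/-- The bracket of the nilradical pairs each nonzero weight with its negative. -/
theorem IsSandwichAlgebra.exists_lie_ne_zero {h : LieSubalgebra ℂ g} [h.IsCartanSubalgebra]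
    (hL : IsSandwichAlgebra g h) (hC : IsClassC L) {α : Module.Dual ℂ h} (hα : α ≠ 0)
    {x : nilpotentRadical L} (hx0 : x ≠ 0) (hx : ∀ v : h, ⁅v, x⁆ = α v • x) :
    ∃ y : nilpotentRadical L, (∀ v : h, ⁅v, y⁆ = -α v • y) ∧ ⁅x, y⁆ ≠ 0 := by
  by_contra! hne
  have hcenter (u w : nilpotentRadical L) : ⁅u, w⁆ ∈ center ℂ (nilpotentRadical L) := by
    rw [mem_maxTrivSubmodule]
    exact fun m => Subtype.ext (hL.sandwich m m.2 u u.2 w w.2)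
  -- By torality it suffices to test `x` against `y` of weight `β`. The bracket is central, so its
  -- weight `α + β` is zero unless it vanishes, and `hne` covers `β = -α`. A central `x` would have
  -- weight zero.
  have hxc : x ∈ center ℂ (nilpotentRadical L) := by
    rw [mem_maxTrivSubmodule]
    intro y
    rw [← lie_skew, neg_eq_zero]
    have hy : y ∈ ⨆ β : Module.Dual ℂ h, weightSpace (nilpotentRadical L) (β : h → ℂ) := by
      rw [hL.toral]; exact LieSubmodule.mem_top y
    refine LieSubmodule.iSup_induction _ (motive := fun y => ⁅x, y⁆ = 0) hy ?_ (lie_zero x)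
      fun y z hy hz => by rw [lie_add, hy, hz, add_zero]
    intro β y hy
    rw [mem_weightSpace] at hy
    by_contra hxy
    refine hxy (hne y fun v => ?_)
    have h1 : ⁅v, ⁅x, y⁆⁆ = (α v + β v) • ⁅x, y⁆ := by
      have : ⁅v, ⁅x, y⁆⁆ = ⁅⁅v, x⁆, y⁆ + ⁅x, ⁅v, y⁆⁆ :=
        Subtype.ext (leibniz_lie (((v : g)) : L) (x : L) (y : L))
      rw [this, hx, hy, smul_lie, lie_smul, add_smul]
    have h2 : ⁅v, ⁅x, y⁆⁆ = 0 :=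
      lie_eq_zero_of_mem_center_nilpotentRadical hL.simple hC (hcenter x y) (v : g)
    rw [h2, eq_comm, smul_eq_zero] at h1
    rw [hy, eq_neg_of_add_eq_zero_right (h1.resolve_right hxy)]
  refine hα (LinearMap.ext fun v => ?_)
  have h1 : ⁅v, x⁆ = 0 := lie_eq_zero_of_mem_center_nilpotentRadical hL.simple hC hxc (v : g)
  rw [hx, smul_eq_zero] at h1
  exact h1.resolve_right hx0

theorem IsSandwichAlgebra.neg_mem_rootSet {h : LieSubalgebra ℂ g} [h.IsCartanSubalgebra]
    (hL : IsSandwichAlgebra g h) (hC : IsClassC L) {α : Module.Dual ℂ h}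
    (hα : α ∈ rootSet h (nilpotentRadical L)) : -α ∈ rootSet h (nilpotentRadical L) := by
  obtain ⟨x, hx0, hx⟩ := mem_weightSet_iff.mp hα.1
  obtain ⟨y, hy, hxy⟩ := hL.exists_lie_ne_zero hC hα.2 hx0 hx
  exact ⟨mem_weightSet_iff.mpr ⟨y, fun h => hxy (by rw [h, lie_zero]), hy⟩, neg_ne_zero.mpr hα.2⟩

end Nilradical

/-! ### Consequences of alignment -/

section Aligned

variable {g G : Type*} [LieRing g] [LieAlgebra ℂ g] [LieRing G]
  [LieAlgebra ℂ G] {φ : g →ₗ⁅ℂ⁆ G}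
  {h : LieSubalgebra ℂ g} {H : LieSubalgebra ℂ G} [h.IsCartanSubalgebra] [H.IsCartanSubalgebra]
  {f : h →ₗ[ℂ] H} {Hs : H}

theorem rootSpace_le_range_of_aligned [FiniteDimensional ℂ G] [IsKilling ℂ G]
    (hs : {W : Submodule ℂ G | ∃ α ∈ rootSet h g,
        W = (weightSpace g (α : h → ℂ)).toSubmodule.map (φ : g →ₗ[ℂ] G)} =
      {W : Submodule ℂ G | ∃ γ ∈ rootSet H G, γ Hs = 0 ∧
        W = (weightSpace G (γ : H → ℂ)).toSubmodule})
    {γ : Weight ℂ H G} (hγ : γ.IsNonZero) (hγs : γ Hs = 0) :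
    (rootSpace H γ).toSubmodule ≤ LinearMap.range (φ : g →ₗ[ℂ] G) := by
  have hmem : (rootSpace H γ).toSubmodule ∈ {W : Submodule ℂ G | ∃ α ∈ rootSet h g,
      W = (weightSpace g (α : h → ℂ)).toSubmodule.map (φ : g →ₗ[ℂ] G)} := by
    rw [hs]
    exact ⟨γ.toLinear, Weight.toLinear_mem_rootSet hγ, hγs,
      congrArg _ (weightSpace_eq_rootSpace (γ : H → ℂ)).symm⟩
  obtain ⟨α, -, hα⟩ := hmem
  rw [hα]
  exact LinearMap.map_le_range

/-- The coroot is the bracket of vectors in the root spaces of `±γ`, both coming from `g`. Its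
preimage commutes with `h`, and `h` is its own normalizer. -/
theorem coroot_mem_range_of_aligned [FiniteDimensional ℂ G] [IsKilling ℂ G]
    (hφ : Function.Injective φ) (hf : ∀ v : h, (f v : G) = φ v)
    (hs : ∀ γ : Weight ℂ H G, γ.IsNonZero → γ Hs = 0 →
      (rootSpace H γ).toSubmodule ≤ LinearMap.range (φ : g →ₗ[ℂ] G))
    {γ : Weight ℂ H G} (hγ : γ.IsNonZero) (hγs : γ Hs = 0) : coroot γ ∈ LinearMap.range f := by
  obtain ⟨c, e, e', ht, he, he'⟩ := exists_isSl2Triple_of_weight_isNonZero hγ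
  have hc := ht.h_eq_coroot hγ he he'
  obtain ⟨a, ha⟩ := hs γ hγ hγs he
  obtain ⟨b, hb⟩ := hs (-γ) hγ.neg (by simp [hγs]) he'
  have hab : φ ⁅a, b⁆ = (coroot γ : G) := by
    rw [← hc, ← ht.lie_e_f, LieHom.map_lie]
    exact congrArg₂ _ ha hb
  have hmem : ⁅a, b⁆ ∈ h := by
    rw [← LieSubalgebra.IsCartanSubalgebra.self_normalizing (H := h),
      LieSubalgebra.mem_normalizer_iff]
    intro v hv
    have : φ ⁅⁅a, b⁆, v⁆ = 0 := by
      rw [LieHom.map_lie, hab, ← hf ⟨v, hv⟩]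
      exact congrArg Subtype.val (trivial_lie_zero H H (coroot γ) (f ⟨v, hv⟩))
    rw [hφ (this.trans (map_zero φ).symm)]
    exact h.zero_mem
  exact ⟨⟨_, hmem⟩, Subtype.ext ((hf _).trans hab)⟩

/-- The roots of `g` separate the points of `h`. A shared root vector shows that each of them is the
restriction of a root vanishing at `Hs`. -/
theorem eq_zero_of_aligned [FiniteDimensional ℂ g] [IsKilling ℂ g] (hφ : Function.Injective φ) (hf : ∀ v : h, (f v : G) = φ v)
    (hs : {W : Submodule ℂ G | ∃ α ∈ rootSet h g,
        W = (weightSpace g (α : h → ℂ)).toSubmodule.map (φ : g →ₗ[ℂ] G)} =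
      {W : Submodule ℂ G | ∃ γ ∈ rootSet H G, γ Hs = 0 ∧
        W = (weightSpace G (γ : H → ℂ)).toSubmodule})
    {v : h} (hv : ∀ γ : Weight ℂ H G, γ.IsNonZero → γ Hs = 0 → γ (f v) = 0) : v = 0 := by
  have hmem : v ∈ ⨅ α : Weight ℂ h g, α.ker := by
    rw [Submodule.mem_iInf]
    intro α
    by_cases hα : α.IsZero
    · exact congrFun hα v
    have hW : (weightSpace g (α : h → ℂ)).toSubmodule.map (φ : g →ₗ[ℂ] G) ∈
        {W : Submodule ℂ G | ∃ γ ∈ rootSet H G, γ Hs = 0 ∧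
          W = (weightSpace G (γ : H → ℂ)).toSubmodule} := by
      rw [← hs]
      exact ⟨α.toLinear, Weight.toLinear_mem_rootSet hα, rfl⟩
    obtain ⟨γ', hγ', hγs, hW⟩ := hW
    obtain ⟨γ, hγ, hγγ'⟩ := exists_weight_of_mem_rootSet hγ'
    obtain ⟨x, hx, hx0⟩ := α.exists_ne_zero
    replace hx : x ∈ weightSpace g (α : h → ℂ) := weightSpace_eq_rootSpace (α : h → ℂ) ▸ hx
    have hφx : φ x ∈ weightSpace G (γ' : H → ℂ) := by
      rw [← LieSubmodule.mem_toSubmodule, ← hW]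
      exact Submodule.mem_map_of_mem hx
    have e1 : ⁅(f v : G), φ x⁆ = γ' (f v) • φ x := (mem_weightSpace _ _).mp hφx (f v)
    have e2 : ⁅(v : g), x⁆ = α v • x := (mem_weightSpace _ _).mp hx v
    have e3 : γ' (f v) = 0 := by
      rw [← hγγ']
      exact hv γ hγ (by rw [hγγ', hγs])
    rw [hf, ← LieHom.map_lie, e2, e3, zero_smul] at e1
    have e4 := hφ (e1.trans (map_zero φ).symm)
    exact (smul_eq_zero.mp e4).resolve_right hx0
  rwa [iInf_ker_weight_eq_bot, Submodule.mem_bot] at hmem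

end Aligned

/-! ### Twice a root is not a root -/

section VerySpecial

variable {L : Type*} [LieRing L] [LieAlgebra ℂ L]
  {G : Type*} [LieRing G] [LieAlgebra ℂ G] [FiniteDimensional ℂ G]
  {ι : L →ₗ⁅ℂ⁆ G} {g : LieSubalgebra ℂ L} {h : LieSubalgebra ℂ g} [h.IsCartanSubalgebra]
  {H : LieSubalgebra ℂ G} [H.IsCartanSubalgebra]

theorem IsVerySpecial.two_smul_notMem_rootSet (hL : IsVerySpecial g h ι H) (hC : IsClassC L)
    {α : Module.Dual ℂ h} (hα : α ∈ rootSet h (nilpotentRadical L)) :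
    (2 : ℂ) • α ∉ rootSet h (nilpotentRadical L) := by
  intro h2α
  obtain ⟨x, hx0, hx⟩ := mem_weightSet_iff.mp hα.1
  obtain ⟨y, hy0, hy⟩ := mem_weightSet_iff.mp h2α.1
  obtain ⟨x', hx', hxx'⟩ := hL.exists_lie_ne_zero hC hα.2 hx0 hx
  have : FiniteDimensional ℂ L := Module.Finite.of_injective (ι : L →ₗ[ℂ] G) hL.injective
  have : IsSimple ℂ g := hL.simple
  have : IsSimple ℂ G := hL.simple_ambient
  obtain ⟨hle, Hs, hs⟩ := hL.aligned
  have hφ : Function.Injective (ι.comp g.incl) := hL.injective.comp Subtype.val_injective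
  let f : h →ₗ[ℂ] H := LinearMap.codRestrict H.toSubmodule
    (((ι.comp g.incl : g →ₗ⁅ℂ⁆ G) : g →ₗ[ℂ] G) ∘ₗ h.toSubmodule.subtype)
    fun v => hle ⟨v, v.2, rfl⟩
  have hf (v : h) : (f v : G) = ι.comp g.incl v := rfl
  have hfinj : Function.Injective f := fun v w hvw =>
    Subtype.ext (hφ (congrArg Subtype.val hvw))
  have hlie (v : h) (u : nilpotentRadical L) : ⁅(f v : G), ι u⁆ = ι (⁅v, u⁆ : nilpotentRadical L) :=
    (ι.map_lie ((v : g) : L) (u : L)).symm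
  have hweight {β : h → ℂ} {u : nilpotentRadical L} (hu : ∀ v : h, ⁅v, u⁆ = β v • u) (v : h) :
      ⁅(f v : G), ι u⁆ = β v • ι u := by
    rw [hlie, hu]
    exact map_smul ι (β v) (u : L)
  have hι0 {u : nilpotentRadical L} (hu : u ≠ 0) : ι u ≠ 0 := fun h0 =>
    hu (Subtype.ext (hL.injective (h0.trans (map_zero ι).symm)))
  have hbr : ι (⁅x, x'⁆ : nilpotentRadical L) = ⁅ι x, ι x'⁆ := ι.map_lie (x : L) (x' : L)
  have hcomm (u : nilpotentRadical L) : ⁅ι u, ⁅ι x, ι x'⁆⁆ = 0 := by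
    rw [← hbr]
    have := hL.sandwich u u.2 x x.2 x' x'.2
    exact (ι.map_lie (u : L) ⁅(x : L), (x' : L)⁆).symm.trans (by rw [this, map_zero])
  -- The bracket of vectors of weights `α` and `-α` commutes with `h`, and by the sandwich condition
  -- with `x` and `x'`.
  obtain ⟨δ, hδ, hδf⟩ := exists_isNonZero_restrict_eq_zero f (x := ι x) (y := ι x')
    (hbr ▸ hι0 hxx') (hcomm x) (hcomm x') fun v => by
      have h1 : ⁅(f v : G), ⁅ι x, ι x'⁆⁆ = (α v + -α v) • ⁅ι x, ι x'⁆ := by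
        rw [leibniz_lie, hweight hx, hweight hx', smul_lie, lie_smul, add_smul]
      rw [h1, add_neg_cancel, zero_smul]
  have hS (γ : Weight ℂ H G) (hγ : γ.IsNonZero) (hγs : γ Hs = 0) := rootSpace_le_range_of_aligned hs hγ hγs
  have hmem : ι y ∈ LinearMap.range ((ι.comp g.incl : g →ₗ⁅ℂ⁆ G) : g →ₗ[ℂ] G) :=
    mem_of_restrict_eq_two_smul f hfinj hL.rank_eq hδ hδf Hs
      (fun γ hγ hγs => coroot_mem_range_of_aligned hφ hf hS hγ hγs)
      (fun v hv => eq_zero_of_aligned hφ hf hs hv) _ hS hα.2 (hι0 hx0) (hweight hx) (hweight hy)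
  obtain ⟨w, hw⟩ := hmem
  have hwy : (w : L) = y := hL.injective hw
  refine hy0 (Subtype.ext ?_)
  exact (Submodule.disjoint_def.mp hL.isCompl.disjoint) y (hwy ▸ w.2) y.2

end VerySpecial

/-! ### The extremal chain and the Killing integer -/

theorem isExtremalRootChain_self_iff {M : Type*} [AddCommGroup M] {Φ : Set M} {α : M}
    (hα : α ∈ Φ) (hneg : -α ∈ Φ) (h2 : (2 : ℤ) • α ∉ Φ ∪ {0}) (h2' : -((2 : ℤ) • α) ∉ Φ ∪ {0})
    (q p : ℕ) : IsExtremalRootChain Φ α α q p ↔ q = 2 ∧ p = 0 := by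
  have hext : IsExtremalRootChain Φ α α 2 0 := by
    refine ⟨?_, fun q p hqp hq _ => ?_⟩
    · rintro _ ⟨j, hj, hj', rfl⟩
      push_cast at hj hj'
      interval_cases j
      · left; convert hneg using 1; module
      · right; simp
      · left; simpa using hα
    -- A longer chain would contain `α - 3α = -2α` or `α + α = 2α`.
    · have hq' : q < 3 := by
        by_contra! hlt
        refine h2' (hqp ⟨-3, by omega, by omega, ?_⟩)
        module
      have hp' : p < 1 := by
        by_contra! hlt
        refine h2 (hqp ⟨1, by omega, by omega, ?_⟩)
        module
      omega
  refine ⟨fun h => ?_, ?_⟩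
  · exact h.unique hext
  · rintro ⟨rfl, rfl⟩
    exact hext

theorem IsExtremalRootChain.killingInteger_eq {M : Type*} [AddCommGroup M] {Φ : Set M} {β α : M}
    {q p : ℕ} (h : IsExtremalRootChain Φ β α q p) : killingInteger Φ β α = q - p := by
  have hex : ∃ qp : ℕ × ℕ, IsExtremalRootChain Φ β α qp.1 qp.2 := ⟨(q, p), h⟩
  rw [killingInteger, dif_pos hex]
  obtain ⟨h1, h2⟩ := hex.choose_spec.unique h
  rw [h1, h2]

theorem unbrokenChain_self_two_zero {M : Type*} [AddCommGroup M] (α : M) :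
    unbrokenChain α α 2 0 = {-α, 0, α} := by
  ext γ
  simp only [unbrokenChain, Set.mem_ofPred_eq, Set.mem_insert_iff, Set.mem_singleton_iff]
  constructor
  · rintro ⟨j, hj, hj', rfl⟩
    push_cast at hj hj'
    interval_cases j
    · left; module
    · right; left; module
    · right; right; module
  · rintro (rfl | rfl | rfl)
    · exact ⟨-2, by norm_num, by norm_num, by module⟩
    · exact ⟨-1, by norm_num, by norm_num, by module⟩
    · exact ⟨0, by norm_num, by norm_num, by module⟩

theorem lemma2p4p1 {L : Type*} [LieRing L] [LieAlgebra ℂ L]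
    {G : Type*} [LieRing G] [LieAlgebra ℂ G] [FiniteDimensional ℂ G]
    (ι : L →ₗ⁅ℂ⁆ G) (g : LieSubalgebra ℂ L) (h : LieSubalgebra ℂ g) [h.IsCartanSubalgebra]
    (H : LieSubalgebra ℂ G) [H.IsCartanSubalgebra]
    (hL : IsVerySpecial g h ι H) (hC : IsClassC L)
    (α : Module.Dual ℂ h) (hα : α ∈ rootSet h (nilpotentRadical L)) :
    (∀ q p : ℕ, IsExtremalRootChain (rootSet h (nilpotentRadical L)) α α q p ↔ q = 2 ∧ p = 0) ∧
    unbrokenChain α α 2 0 = {-α, 0, α} ∧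
    killingInteger (rootSet h (nilpotentRadical L)) α α = 2 := by
  have hneg := hL.neg_mem_rootSet hC hα
  have hnot {β : Module.Dual ℂ h} (hβ : β ∈ rootSet h (nilpotentRadical L)) :
      (2 : ℂ) • β ∉ rootSet h (nilpotentRadical L) ∪ {0} := by
    rintro (h2 | h2)
    · exact hL.two_smul_notMem_rootSet hC hβ h2
    · exact hβ.2 ((smul_eq_zero.mp h2).resolve_left two_ne_zero)
  have hiff := isExtremalRootChain_self_iff hα hneg
    (by
      rw [show (2 : ℤ) • α = (2 : ℂ) • α by module]
      exact hnot hα) (by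
      rw [show -((2 : ℤ) • α) = (2 : ℂ) • -α by module]
      exact hnot hneg)
  refine ⟨hiff, unbrokenChain_self_two_zero α, ?_⟩
  rw [((hiff 2 0).mpr ⟨rfl, rfl⟩).killingInteger_eq]
  norm_num
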